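/- For a finite graph $H$ on $h$ vertices, $\gamma \in [0,1]$ and $\varepsilon > 0$, let $\delta(\varepsilon,H;\gamma)$ denote the maximum $\delta \in [0,1]$ such that, for every $n$, every $n$-vertex graph with fewer than $\delta n^h$ copies of $H$ (subgraphs isomorphic to $H$) and with minimum degree at least $\gamma n$ can be made $H$-free (i.e. to contain no subgraph isomorphic to $H$) by deleting at most $\varepsilon n^2$ edges. The linear removal threshold of $H$ is $$\delta_{\text{lin-rem}}(H) = \inf\{\gamma \in [0,1] : \text{there exists } \mu>0 \text{ such that } \delta(\varepsilon,H;\gamma) \ge \mu\varepsilon \text{ for all } \varepsilon\in(0,1)\}.$$ Let $K_r[s]$ denote the complete $r$-partite graph with $s$ vertices in each part. Then for all integers $r \ge 3$ and $s \ge 2$, $$\delta_{\text{lin-rem}}(K_r[s]) = \frac{r-2}{r-1}.$$ -/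

import Mathlib

namespace MinDegreeRemoval

/-- `G` can be made `H`-free by deleting at most `m` edges. -/
def CanMakeFree {V W : Type*} (H : SimpleGraph W) (G : SimpleGraph V) (m : ℝ) : Prop :=
  ∃ E : Finset (Sym2 V), (E : Set (Sym2 V)) ⊆ G.edgeSet ∧ (E.card : ℝ) ≤ m ∧
    H.Free (G.deleteEdges (E : Set (Sym2 V)))

open Classical in
/-- `δ` is admissible for `(ε, H, γ)`: every graph on `n` vertices (for every `n`) with fewer than
`δ * n ^ |V(H)|` copies of `H` and minimum degree at least `γ * n` can be made `H`-free by deleting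
at most `ε * n ^ 2` edges. Copies are unlabelled, i.e. subgraphs isomorphic to `H`. -/
def Admissible {W : Type*} [Fintype W] (H : SimpleGraph W) (γ ε δ : ℝ) : Prop :=
  ∀ (n : ℕ) (G : SimpleGraph (Fin n)),
    (G.copyCount H : ℝ) < δ * (n : ℝ) ^ Fintype.card W →
    γ * (n : ℝ) ≤ (G.minDegree : ℝ) →
    CanMakeFree H G (ε * (n : ℝ) ^ 2)

/-- The restricted removal function `δ(ε, H; γ)`: the largest admissible `δ ∈ [0, 1]`.
The supremum is attained, see `isGreatest_removalDelta`. -/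
noncomputable def removalDelta {W : Type*} [Fintype W] (H : SimpleGraph W) (γ ε : ℝ) : ℝ :=
  sSup {δ : ℝ | δ ∈ Set.Icc (0 : ℝ) 1 ∧ Admissible H γ ε δ}

theorem isGreatest_removalDelta {W : Type*} [Fintype W] (H : SimpleGraph W) (γ ε : ℝ) :
    IsGreatest {δ : ℝ | δ ∈ Set.Icc (0 : ℝ) 1 ∧ Admissible H γ ε δ} (removalDelta H γ ε) := by
  have hbdd : BddAbove {δ : ℝ | δ ∈ Set.Icc (0 : ℝ) 1 ∧ Admissible H γ ε δ} :=
    ⟨1, fun δ hδ => hδ.1.2⟩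
  have h0 : (0 : ℝ) ∈ {δ : ℝ | δ ∈ Set.Icc (0 : ℝ) 1 ∧ Admissible H γ ε δ} := by
    refine ⟨⟨le_rfl, zero_le_one⟩, fun n G hlt _ => ?_⟩
    rw [zero_mul] at hlt
    exact absurd hlt (not_lt.mpr (Nat.cast_nonneg _))
  refine ⟨⟨⟨le_csSup hbdd h0, csSup_le ⟨0, h0⟩ fun δ hδ => hδ.1.2⟩, ?_⟩,
    fun δ hδ => le_csSup hbdd hδ⟩
  intro n G hlt hdeg
  have hpos : (0 : ℝ) < (n : ℝ) ^ Fintype.card W := by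
    rcases (show (0 : ℝ) ≤ (n : ℝ) ^ Fintype.card W by positivity).lt_or_eq with h | h
    · exact h
    · rw [← h, mul_zero] at hlt
      exact absurd hlt (not_lt.mpr (Nat.cast_nonneg _))
  obtain ⟨δ, hδ, hlt'⟩ := exists_lt_of_lt_csSup ⟨0, h0⟩ ((div_lt_iff₀ hpos).mpr hlt)
  exact hδ.2 n G ((div_lt_iff₀ hpos).mp hlt') hdeg

/-- The linear removal threshold of `H`. -/
noncomputable def linearRemovalThreshold {W : Type*} [Fintype W] (H : SimpleGraph W) : ℝ :=
  sInf {γ : ℝ | γ ∈ Set.Icc (0 : ℝ) 1 ∧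
    ∃ μ : ℝ, 0 < μ ∧ ∀ ε : ℝ, ε ∈ Set.Ioo (0 : ℝ) 1 → μ * ε ≤ removalDelta H γ ε}

end MinDegreeRemoval

/-!
If `γ > (r - 2) / (r - 1)`, any `i < r` vertices of a graph of minimum degree `γ n` have a positive
proportion of common neighbours, so a greedy choice of vertices shows that the graph has positive
`K_r`-density, and by convexity positive `K_r[s]`-density. Hence, unless `n` is bounded, there are
always `Ω(n ^ (r s))` copies of `K_r[s]`, and no graph with few copies needs to be treated.

If `γ ≤ (r - 2) / (r - 1)`, take a balanced complete `(r - 1)`-partite graph on `Θ(N)` vertices and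
place `N` disjoint cliques of size `2 s` in one of its parts. Fewer than `N` deletions leave some
clique intact together with its neighbours in a copy of `K_r[s]`. On the other hand every copy has
two of its classes inside one clique, hence three vertices there, so the density of copies is
`O(N ^ (-2))`, while the proportion `ε` of edges to delete is of order `N ^ (-1)`.
-/

namespace MinDegreeRemoval

open Finset SimpleGraph
open scoped BigOperators

section BlowUp

theorem pow_expect_le_expect_pow {ι : Type*} [Fintype ι] [Nonempty ι] {f : ι → ℝ}
    (hf : ∀ i, 0 ≤ f i) (n : ℕ) : (𝔼 i, f i) ^ n ≤ 𝔼 i, f i ^ n := by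
  have h := Real.pow_arith_mean_le_arith_mean_pow univ (fun _ : ι => (Fintype.card ι : ℝ)⁻¹) f
    (fun _ _ => by positivity) (by simp) (fun i _ => hf i) n
  simpa only [Fintype.expect_eq_sum_div_card, div_eq_inv_mul, mul_sum] using h

theorem expect_fin_succ_pi {V : Type*} [Fintype V] {k : ℕ} (f : (Fin (k + 1) → V) → ℝ) :
    𝔼 v, f v = 𝔼 v : Fin k → V, 𝔼 u, f (Fin.cons u v) := by
  rw [expect_comm, ← expect_product' univ univ fun u v => f (Fin.cons u v), univ_product_univ]
  exact (Fintype.expect_equiv (Fin.consEquiv fun _ => V) _ _ fun _ => rfl).symm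

theorem pow_expect_le_expect_prod_blowUp {V : Type*} [Fintype V] [Nonempty V] (s k : ℕ)
    {f : (Fin k → V) → ℝ} (hf : ∀ v, 0 ≤ f v) :
    (𝔼 v, f v) ^ s ^ k ≤
      𝔼 x : Fin k → Fin s → V, ∏ c : Fin k → Fin s, f fun i => x i (c i) := by
  induction k with
  | zero => simp [Subsingleton.elim _ (default : Fin 0 → V)]
  | succ k ih =>
    let g (y : Fin s → V) (v : Fin k → V) : ℝ := ∏ j, f (Fin.cons (y j) v)
    have hg (y : Fin s → V) (v : Fin k → V) : 0 ≤ g y v := prod_nonneg fun _ _ => hf _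
    have hpow (v : Fin k → V) : (𝔼 u, f (Fin.cons u v)) ^ s = 𝔼 y, g y v := by
      rw [expect_pow, Fintype.piFinset_univ]
    calc (𝔼 v, f v) ^ s ^ (k + 1)
        = ((𝔼 v : Fin k → V, 𝔼 u, f (Fin.cons u v)) ^ s) ^ s ^ k := by
          rw [expect_fin_succ_pi, ← pow_mul, ← pow_succ']
      _ ≤ (𝔼 v : Fin k → V, (𝔼 u, f (Fin.cons u v)) ^ s) ^ s ^ k := by
          gcongr
          · exact pow_nonneg (expect_nonneg fun _ _ => expect_nonneg fun _ _ => hf _) _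
          · exact pow_expect_le_expect_pow (fun _ => expect_nonneg fun _ _ => hf _) s
      _ = (𝔼 y, 𝔼 v, g y v) ^ s ^ k := by
          simp only [hpow]
          rw [expect_comm]
      _ ≤ 𝔼 y, (𝔼 v, g y v) ^ s ^ k :=
          pow_expect_le_expect_pow (fun y => expect_nonneg fun v _ => hg y v) _
      _ ≤ 𝔼 y, 𝔼 x : Fin k → Fin s → V, ∏ c : Fin k → Fin s, g y fun i => x i (c i) :=
          expect_le_expect fun y _ => ih (hg y)
      _ = 𝔼 x : Fin (k + 1) → Fin s → V, ∏ c : Fin (k + 1) → Fin s, f fun i => x i (c i) := by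
          rw [expect_fin_succ_pi, expect_comm]
          refine expect_congr rfl fun x _ => expect_congr rfl fun y _ => ?_
          rw [← (Fin.consEquiv fun _ => Fin s).prod_comp, Fintype.prod_prod_type, prod_comm]
          refine prod_congr rfl fun c _ => prod_congr rfl fun j _ => congrArg f ?_
          funext i
          cases i using Fin.cases <;> rfl

end BlowUp

section HomDensity

theorem top_le_comap_cons_iff {V : Type*} {G : SimpleGraph V} {k : ℕ} {u : V} {v : Fin k → V} :
    ⊤ ≤ G.comap (Fin.cons u v : Fin (k + 1) → V) ↔ ⊤ ≤ G.comap v ∧ ∀ i, G.Adj u (v i) := by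
  simp only [SimpleGraph.le_iff_adj, top_adj, comap_adj, Fin.forall_fin_succ, Fin.cons_zero,
    Fin.cons_succ, Fin.succ_inj, ne_eq, not_true_eq_false, false_imp_iff, true_and,
    Fin.succ_ne_zero, (Fin.succ_ne_zero _).symm, not_false_eq_true, true_imp_iff, forall_and]
  exact ⟨fun h => ⟨h.2.2, h.2.1⟩, fun h => ⟨fun i => (h.2 i).symm, h.2, h.1⟩⟩

variable {V W : Type*} [Fintype V] [Fintype W] [DecidableEq W]

open Classical in
/-- The homomorphism density `t(F, G)`: the probability that a uniformly random map from the
vertices of `F` to those of `G` is a graph homomorphism, the latter being expressed as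
`F ≤ G.comap φ`. -/
noncomputable def homDensity (F : SimpleGraph W) (G : SimpleGraph V) : ℝ :=
  𝔼 φ : W → V, if F ≤ G.comap φ then 1 else 0

open Classical in
theorem card_pow_mul_homDensity (F : SimpleGraph W) (G : SimpleGraph V) :
    (Fintype.card V : ℝ) ^ Fintype.card W * homDensity F G = #{φ : W → V | F ≤ G.comap φ} := by
  rw [homDensity, ← Nat.cast_pow, ← Fintype.card_fun, Fintype.card_mul_expect, sum_boole]

theorem pow_homDensity_le_homDensity_blowUp [Nonempty V] {k : ℕ} (s : ℕ) (F : SimpleGraph (Fin k))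
    (G : SimpleGraph V) :
    homDensity F G ^ s ^ k ≤ homDensity (F.comap (Prod.fst : Fin k × Fin s → Fin k)) G := by
  classical
  refine (pow_expect_le_expect_prod_blowUp s k fun v => by positivity).trans ?_
  have hcurry : homDensity (F.comap (Prod.fst : Fin k × Fin s → Fin k)) G =
      𝔼 x : Fin k → Fin s → V,
        if F.comap Prod.fst ≤ G.comap (fun a : Fin k × Fin s => x a.1 a.2) then 1 else 0 :=
    Fintype.expect_equiv (Equiv.curry (Fin k) (Fin s) V) _ _ fun _ => rfl
  rw [hcurry]
  refine expect_le_expect fun x _ => ?_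
  split_ifs with hx
  · exact prod_le_one (fun _ _ => by positivity) fun _ _ => by split_ifs <;> norm_num
  · obtain ⟨⟨i, j⟩, ⟨i', j'⟩, hF, hG⟩ :
        ∃ a b : Fin k × Fin s, F.Adj a.1 b.1 ∧ ¬ G.Adj (x a.1 a.2) (x b.1 b.2) := by
      simpa [SimpleGraph.le_iff_adj] using hx
    refine (prod_eq_zero (mem_univ fun l => if l = i then j else j') (if_neg fun h => hG ?_)).le
    simpa [hF.ne'] using h hF

variable {γ : ℝ}

open Classical in
theorem le_expect_ite_forall_adj [Nonempty V] (G : SimpleGraph V)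
    (hdeg : ∀ v, γ * Fintype.card V ≤ G.degree v) {k : ℕ} (v : Fin k → V) :
    1 - k * (1 - γ) ≤ 𝔼 u, if ∀ i, G.Adj u (v i) then (1 : ℝ) else 0 := by
  have hnbr (i : Fin k) : γ ≤ 𝔼 u, if G.Adj u (v i) then (1 : ℝ) else 0 := by
    rw [Fintype.expect_eq_sum_div_card, sum_boole, le_div_iff₀ (by simp [Fintype.card_pos])]
    simpa [G.adj_comm _ (v i), ← card_neighborFinset_eq_degree, neighborFinset_eq_filter]
      using hdeg (v i)
  have hunion (u : V) : 1 - ∑ i, (1 - if G.Adj u (v i) then (1 : ℝ) else 0) ≤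
      if ∀ i, G.Adj u (v i) then (1 : ℝ) else 0 := by
    have hnonneg (i : Fin k) : 0 ≤ 1 - if G.Adj u (v i) then (1 : ℝ) else 0 := by
      split_ifs <;> norm_num
    split_ifs with h
    · exact sub_le_self _ (sum_nonneg fun i _ => hnonneg i)
    · obtain ⟨i, hi⟩ := not_forall.1 h
      have := single_le_sum (fun i _ => hnonneg i) (mem_univ i)
      rw [if_neg hi] at this
      linarith
  calc 1 - k * (1 - γ) = 1 - ∑ _i : Fin k, (1 - γ) := by
        simp only [sum_const, card_univ, Fintype.card_fin, nsmul_eq_mul]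
    _ ≤ 1 - ∑ i, (1 - 𝔼 u, if G.Adj u (v i) then (1 : ℝ) else 0) := by
        gcongr with i
        exact hnbr i
    _ = 𝔼 u, (1 - ∑ i, (1 - if G.Adj u (v i) then (1 : ℝ) else 0)) := by
        simp only [expect_sub_distrib, expect_sum_comm, Fintype.expect_const]
    _ ≤ _ := expect_le_expect fun u _ => hunion u

open Classical in
theorem prod_range_le_homDensity_top [Nonempty V] {G : SimpleGraph V}
    (hdeg : ∀ v, γ * Fintype.card V ≤ G.degree v) (r : ℕ)
    (hγ : ∀ i < r, (0 : ℝ) ≤ 1 - i * (1 - γ)) :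
    ∏ i ∈ range r, (1 - i * (1 - γ)) ≤ homDensity (⊤ : SimpleGraph (Fin r)) G := by
  induction r with
  | zero => simp [homDensity, Subsingleton.elim (⊤ : SimpleGraph (Fin 0)) ⊥]
  | succ r ih =>
    calc ∏ i ∈ range (r + 1), (1 - i * (1 - γ))
        ≤ homDensity (⊤ : SimpleGraph (Fin r)) G * (1 - r * (1 - γ)) := by
          rw [prod_range_succ]
          gcongr
          · exact hγ r r.lt_succ_self
          · exact ih fun i hi => hγ i (hi.trans r.lt_succ_self)
      _ ≤ 𝔼 v : Fin r → V, (if ⊤ ≤ G.comap v then 1 else 0) *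
            𝔼 u, if ∀ i, G.Adj u (v i) then (1 : ℝ) else 0 := by
          rw [homDensity, expect_mul]
          exact expect_le_expect fun v _ => mul_le_mul_of_nonneg_left
            (le_expect_ite_forall_adj G hdeg v) (by positivity)
      _ = homDensity (⊤ : SimpleGraph (Fin (r + 1))) G := by
          rw [homDensity, expect_fin_succ_pi]
          refine expect_congr rfl fun v _ => ?_
          simp only [top_le_comap_cons_iff, ite_and, mul_expect, ite_mul, one_mul, zero_mul]

end HomDensity

section Counting

theorem card_forall_fiber_eq_mul_le {V W K : Type*} [Fintype V] [Fintype W] [DecidableEq W]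
    [DecidableEq K] (κ : V → K) {q : ℕ} (hq : ∀ k, #{v | κ v = k} ≤ q) {u : W} {S : Finset W}
    (hu : u ∉ S) :
    #{y : W → V | ∀ w ∈ S, κ (y w) = κ (y u)} * Fintype.card V ^ #S ≤
      q ^ #S * Fintype.card V ^ Fintype.card W := by
  classical
  have hfiber (b : ↥Sᶜ → V) :
      #{y ∈ {y : W → V | ∀ w ∈ S, κ (y w) = κ (y u)} | Sᶜ.restrict y = b} ≤ q ^ #S := by
    let T : Finset V := {v | κ v = κ (b ⟨u, mem_compl.2 hu⟩)}
    calc _ ≤ #(Fintype.piFinset fun _ : S => T) := by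
          refine card_le_card_of_injOn S.restrict ?_ fun y hy y' hy' h => ?_
          · intro y hy
            obtain ⟨hκ, rfl⟩ := by simpa using hy
            exact Fintype.mem_piFinset.2 fun w => mem_filter.2 ⟨mem_univ _, hκ w w.2⟩
          · have hb := (mem_filter.1 hy).2.trans (mem_filter.1 hy').2.symm
            funext w
            by_cases hw : w ∈ S
            · exact congrFun h ⟨w, hw⟩
            · exact congrFun hb ⟨w, mem_compl.2 hw⟩
      _ ≤ q ^ #S := by
          rw [Fintype.card_piFinset, prod_const, card_univ, Fintype.card_coe]
          exact Nat.pow_le_pow_left (hq _) _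
  calc _ ≤ q ^ #S * Fintype.card (↥Sᶜ → V) * Fintype.card V ^ #S :=
        Nat.mul_le_mul_right _ (card_le_mul_card_image_of_maps_to (fun _ _ => mem_univ _) _
          fun b _ => hfiber b)
    _ = _ := by
        rw [Fintype.card_fun, Fintype.card_coe, mul_assoc, ← pow_add, card_compl_add_card]

theorem card_mul_le_of_subset_biUnion {α ι : Type*} [DecidableEq α] {S : Finset α}
    {T : Finset ι} {f : ι → Finset α} {m b : ℕ}
    (hS : S ⊆ T.biUnion f) (hf : ∀ i ∈ T, #(f i) * m ≤ b) :
    #S * m ≤ #T * b :=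
  calc #S * m ≤ (∑ i ∈ T, #(f i)) * m :=
        Nat.mul_le_mul_right _ ((card_le_card hS).trans card_biUnion_le)
    _ ≤ #T * b := by
        rw [sum_mul, ← smul_eq_mul]
        exact sum_le_card_nsmul _ _ _ hf

theorem card_filter_fst_ne_snd_le (ι : Type*) [Fintype ι] [DecidableEq ι] :
    #{p : ι × ι | p.1 ≠ p.2} ≤ Fintype.card ι ^ 2 := by
  simpa [sq] using card_filter_le (univ : Finset (ι × ι)) fun p => p.1 ≠ p.2

variable {V W : Type*} [Fintype V] [Fintype W]

open Classical in
theorem card_not_injective_mul_le [DecidableEq W] :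
    #{y : W → V | ¬ Function.Injective y} * Fintype.card V ≤
      Fintype.card W ^ 2 * Fintype.card V ^ Fintype.card W := by
  have hcover : ({y : W → V | ¬ Function.Injective y} : Finset (W → V)) ⊆
      ({p | p.1 ≠ p.2} : Finset (W × W)).biUnion fun p => {y | y p.2 = y p.1} := by
    intro y hy
    obtain ⟨a, b, hab, hne⟩ := by simpa [Function.Injective] using hy
    simpa using ⟨b, a, Ne.symm hne, hab⟩
  refine (card_mul_le_of_subset_biUnion hcover fun p hp => ?_).trans
    (Nat.mul_le_mul_right _ (card_filter_fst_ne_snd_le W))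
  simpa using card_forall_fiber_eq_mul_le (V := V) id (q := 1)
    (fun k => card_le_one.2 (by simp)) (notMem_singleton.2 (mem_filter.1 hp).2)

theorem card_exists_classes_fiber_eq_mul_le {K : Type*} [DecidableEq K] {k s q : ℕ}
    (hs : 2 ≤ s) (κ : V → K) (hq : ∀ c, #{v | κ v = c} ≤ q) :
    #{y : Fin k × Fin s → V | ∃ a b, a ≠ b ∧ ∀ j j', κ (y (a, j)) = κ (y (b, j'))} *
        Fintype.card V ^ 2 ≤
      k ^ 2 * (q ^ 2 * Fintype.card V ^ Fintype.card (Fin k × Fin s)) := by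
  classical
  let j₀ : Fin s := ⟨0, by omega⟩
  let j₁ : Fin s := ⟨1, by omega⟩
  let pair (c : Fin k × Fin k) : Finset (Fin k × Fin s) := {(c.1, j₁), (c.2, j₀)}
  have hcover : ({y | ∃ a b, a ≠ b ∧ ∀ j j', κ (y (a, j)) = κ (y (b, j'))} :
      Finset (Fin k × Fin s → V)) ⊆ ({c | c.1 ≠ c.2} : Finset (Fin k × Fin k)).biUnion
        fun c => {y | ∀ w ∈ pair c, κ (y w) = κ (y (c.1, j₀))} := by
    intro y hy
    obtain ⟨a, b, hab, h⟩ := (mem_filter.1 hy).2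
    simpa [pair] using ⟨a, b, hab, (h j₁ j₀).trans (h j₀ j₀).symm, (h j₀ j₀).symm⟩
  refine (card_mul_le_of_subset_biUnion hcover fun c hc => ?_).trans
    (Nat.mul_le_mul_right _ (by simpa using card_filter_fst_ne_snd_le (Fin k)))
  have hc : c.1 ≠ c.2 := (mem_filter.1 hc).2
  have hcard : #(pair c) = 2 := card_pair (by simp [hc])
  simpa only [hcard] using
    card_forall_fiber_eq_mul_le κ hq (show (c.1, j₀) ∉ pair c by simp [pair, j₀, j₁, hc])

open Classical in
theorem labelledCopyCount_eq_card_filter (G : SimpleGraph V) (H : SimpleGraph W) :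
    G.labelledCopyCount H = #{y : W → V | Function.Injective y ∧ H ≤ G.comap y} := by
  rw [labelledCopyCount, ← Fintype.card_subtype]
  exact Fintype.card_congr
    { toFun := fun f => ⟨f, f.injective, f.toHom.le_comap⟩
      invFun := fun y => ⟨⟨y.1, fun h => y.2.2 h⟩, y.2.1⟩
      left_inv := fun _ => rfl
      right_inv := fun _ => rfl }

theorem labelledCopyCount_le_mul_copyCount (G : SimpleGraph V) (H : SimpleGraph W) :
    G.labelledCopyCount H ≤ Fintype.card W ^ Fintype.card W * G.copyCount H := by
  classical
  rw [copyCount_eq_card_image_copyToSubgraph, labelledCopyCount, ← card_univ]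
  refine card_le_mul_card_image _ _ fun G' hG' => ?_
  obtain ⟨g, -, rfl⟩ := mem_image.1 hG'
  let e : W ≃ g.toSubgraph.verts := g.isoToSubgraph.toEquiv
  have hmem {f : H.Copy G} (hf : f.toSubgraph = g.toSubgraph) (w : W) :
      f w ∈ g.toSubgraph.verts := by
    simp [← hf]
  calc _ ≤ Fintype.card (W → g.toSubgraph.verts) := by
        refine card_le_card_of_injOn
          (fun f w => if h : f w ∈ g.toSubgraph.verts then ⟨f w, h⟩ else e w) (by simp)
          fun f hf f' hf' h => ?_
        ext w
        simpa only [dif_pos (hmem (mem_filter.1 hf).2 w), dif_pos (hmem (mem_filter.1 hf').2 w),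
          Subtype.mk.injEq] using congrFun h w
    _ = Fintype.card W ^ Fintype.card W := by
        rw [Fintype.card_fun, Fintype.card_congr e]

theorem half_mul_pow_le_mul_copyCount [DecidableEq W] [Nonempty V] {H : SimpleGraph W}
    {G : SimpleGraph V} {α : ℝ} (hα : α ≤ homDensity H G)
    (hV : 2 * (Fintype.card W : ℝ) ^ 2 ≤ α * Fintype.card V) :
    α / 2 * Fintype.card V ^ Fintype.card W ≤
      (Fintype.card W : ℝ) ^ Fintype.card W * G.copyCount H := by
  classical
  set h := Fintype.card W
  set n : ℝ := (Fintype.card V : ℝ)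
  have hn : 0 < n := Nat.cast_pos.2 Fintype.card_pos
  have hhom : α * n ^ h ≤ #{y : W → V | H ≤ G.comap y} := by
    rw [← card_pow_mul_homDensity, mul_comm]
    gcongr
  have hsplit : (#{y : W → V | H ≤ G.comap y} : ℝ) ≤
      G.labelledCopyCount H + #{y : W → V | ¬ Function.Injective y} := by
    rw [labelledCopyCount_eq_card_filter]
    norm_cast
    refine (card_le_card fun y hy => ?_).trans (card_union_le _ _)
    by_cases hinj : Function.Injective y <;> simp_all
  have hdegenerate : (#{y : W → V | ¬ Function.Injective y} : ℝ) ≤ α / 2 * n ^ h := by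
    refine le_of_mul_le_mul_right ?_ hn
    calc (#{y : W → V | ¬ Function.Injective y} : ℝ) * n ≤ h ^ 2 * n ^ h := by
          simp only [n, h]; exact_mod_cast card_not_injective_mul_le (V := V) (W := W)
      _ ≤ α * n / 2 * n ^ h := by gcongr; linarith
      _ = α / 2 * n ^ h * n := by ring
  have hlabel : (G.labelledCopyCount H : ℝ) ≤ h ^ h * G.copyCount H := by
    exact_mod_cast labelledCopyCount_le_mul_copyCount G H
  linarith

end Counting

section LinearRemoval

variable {W : Type*} [Fintype W] {H : SimpleGraph W} {γ : ℝ}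

/-- The linear removal property of `H` for graphs of relative minimum degree at least `γ`, whose
infimum over `γ ∈ [0, 1]` is the linear removal threshold. -/
def HasLinearRemoval (H : SimpleGraph W) (γ : ℝ) : Prop :=
  ∃ μ : ℝ, 0 < μ ∧ ∀ ε ∈ Set.Ioo (0 : ℝ) 1, μ * ε ≤ removalDelta H γ ε

open Classical in
theorem hasLinearRemoval_of_le_copyCount {β : ℝ} (hβ : 0 < β)
    (h : ∀ (n : ℕ) (G : SimpleGraph (Fin n)), γ * n ≤ G.minDegree → ¬ H.Free G →
      β * n ^ Fintype.card W ≤ G.copyCount H) :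
    HasLinearRemoval H γ := by
  refine ⟨min β 1, by positivity, fun ε hε => ?_⟩
  have hlt : min β 1 * ε ≤ min β 1 := mul_le_of_le_one_right (by positivity) hε.2.le
  refine (isGreatest_removalDelta H γ ε).2
    ⟨⟨mul_nonneg (by positivity) hε.1.le, hlt.trans (min_le_right _ _)⟩, fun n G hcopies hdeg => ?_⟩
  refine ⟨∅, by simp, by simpa using mul_nonneg hε.1.le (sq_nonneg _), ?_⟩
  rw [coe_empty, deleteEdges_empty]
  refine not_not.1 fun hfree => ?_
  have := (h n G hdeg hfree).trans_lt hcopies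
  exact (hlt.trans (min_le_left _ _)).not_gt (lt_of_mul_lt_mul_right this (by positivity))

open Classical in
theorem hasLinearRemoval_of_le_homDensity [DecidableEq W] {α : ℝ} (hα : 0 < α)
    (h : ∀ (n : ℕ) [NeZero n] (G : SimpleGraph (Fin n)), γ * n ≤ G.minDegree →
      α ≤ homDensity H G) :
    HasLinearRemoval H γ := by
  set k := Fintype.card W
  obtain ⟨n₀, hn₀⟩ := exists_nat_ge (2 * (k : ℝ) ^ 2 / α)
  rw [div_le_iff₀ hα] at hn₀
  have hk : (0 : ℝ) < (k : ℝ) ^ k := by exact_mod_cast Nat.pow_self_pos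
  refine hasLinearRemoval_of_le_copyCount
    (β := min (α / 2 / k ^ k) (1 / (n₀ + 1) ^ k)) (by positivity) fun n G hdeg hfree => ?_
  rcases lt_or_ge n (n₀ + 1) with hn | hn
  · -- A single copy already exceeds `β * n ^ k`.
    have hcopy : (1 : ℝ) ≤ G.copyCount H := by
      exact_mod_cast copyCount_pos.2 (not_free.1 hfree)
    calc min (α / 2 / k ^ k) (1 / (n₀ + 1) ^ k) * (n : ℝ) ^ k
        ≤ 1 / (n₀ + 1) ^ k * (n₀ + 1) ^ k := by
          gcongr
          · exact min_le_right _ _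
          · exact_mod_cast hn.le
      _ = 1 := one_div_mul_cancel (by positivity)
      _ ≤ G.copyCount H := hcopy
  · have : NeZero n := ⟨by omega⟩
    have hlarge : 2 * (k : ℝ) ^ 2 ≤ α * Fintype.card (Fin n) := by
      rw [Fintype.card_fin, mul_comm α]
      refine hn₀.trans ?_
      gcongr
      omega
    have hcount := half_mul_pow_le_mul_copyCount (h n G hdeg) hlarge
    rw [Fintype.card_fin] at hcount
    calc min (α / 2 / k ^ k) (1 / (n₀ + 1) ^ k) * (n : ℝ) ^ k
        ≤ α / 2 / k ^ k * (n : ℝ) ^ k := by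
          gcongr
          exact min_le_left _ _
      _ = α / 2 * (n : ℝ) ^ k / k ^ k := by ring
      _ ≤ G.copyCount H := (div_le_iff₀' hk).2 hcount

end LinearRemoval

section Transfer

variable {V V' W : Type*} {H : SimpleGraph W} {G : SimpleGraph V} {G' : SimpleGraph V'}

theorem CanMakeFree.of_iso {m : ℝ} (h : CanMakeFree H G m) (φ : G ≃g G') :
    CanMakeFree H G' m := by
  classical
  obtain ⟨E, hsub, hcard, hfree⟩ := h
  let ψ : G.deleteEdges (E : Set (Sym2 V)) ≃g
      G'.deleteEdges (E.image (Sym2.map φ) : Set (Sym2 V')) :=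
    ⟨φ.toEquiv, fun {a b} => by
      have hmem : (∃ z ∈ E, z.map φ = s(φ a, φ b)) ↔ s(a, b) ∈ E := by
        simp only [← Sym2.map_mk, (Sym2.map.injective φ.injective).eq_iff, exists_eq_right]
      have hadj : G'.Adj (φ a) (φ b) ↔ G.Adj a b := φ.map_adj_iff
      simp [hmem, hadj]⟩
  refine ⟨E.image (Sym2.map φ), ?_, (Nat.cast_le.2 card_image_le).trans hcard,
    (free_congr_right ψ).1 hfree⟩
  rw [coe_image, Set.image_subset_iff]
  exact fun z hz => φ.toHom.map_mem_edgeSet (hsub hz)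

theorem labelledCopyCount_le_of_copy [Fintype V] [Fintype V'] [Fintype W] (f : Copy G G') :
    G.labelledCopyCount H ≤ G'.labelledCopyCount H := by
  classical
  exact Fintype.card_le_of_injective (fun g : Copy H G => f.comp g) fun g g' h =>
    Copy.ext fun w => f.injective (DFunLike.congr_fun h w)

open Classical in
theorem Admissible.canMakeFree [Fintype V] [Fintype W] {γ ε δ : ℝ} (h : Admissible H γ ε δ)
    (hcopies : (G.labelledCopyCount H : ℝ) < δ * (Fintype.card V : ℝ) ^ Fintype.card W)
    (hdeg : γ * Fintype.card V ≤ G.minDegree) :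
    CanMakeFree H G (ε * (Fintype.card V : ℝ) ^ 2) := by
  have φ := G.overFinIso rfl
  refine (h _ _ (lt_of_le_of_lt ?_ hcopies) (by rwa [← φ.minDegree_eq])).of_iso φ.symm
  exact Nat.cast_le.2
    (copyCount_le_labelledCopyCount.trans (labelledCopyCount_le_of_copy φ.symm.toCopy))

open Classical in
theorem not_hasLinearRemoval_of_tendsto_card [Fintype W] {γ C c : ℝ} {V : ℕ → Type*}
    [∀ N, Fintype (V N)] {G : ∀ N, SimpleGraph (V N)}
    (hV : Filter.Tendsto (fun N => Fintype.card (V N)) Filter.atTop Filter.atTop)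
    (hdeg : ∀ N, γ * Fintype.card (V N) ≤ (G N).minDegree)
    (hcopies : ∀ N, ((G N).labelledCopyCount H : ℝ) * Fintype.card (V N) ^ 2 ≤
      C * Fintype.card (V N) ^ Fintype.card W)
    (hc : 0 < c) (hfar : ∀ N, ¬ CanMakeFree H (G N) (c * Fintype.card (V N))) :
    ¬ HasLinearRemoval H γ := by
  rintro ⟨μ, hμ, hlin⟩
  obtain ⟨N, hN⟩ := (((tendsto_natCast_atTop_atTop (R := ℝ)).comp hV).eventually_gt_atTop
    (max c (C / (μ * c)))).exists
  set n : ℝ := (Fintype.card (V N) : ℝ)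
  have hcn : c < n := (le_max_left _ _).trans_lt hN
  have hn : 0 < n := hc.trans hcn
  have hCn : C < μ * c * n := (div_lt_iff₀' (by positivity)).1 ((le_max_right _ _).trans_lt hN)
  have hfew : ((G N).labelledCopyCount H : ℝ) < μ * (c / n) * n ^ Fintype.card W := by
    refine lt_of_mul_lt_mul_right ((hcopies N).trans_lt ?_) (sq_nonneg n)
    calc C * n ^ Fintype.card W < μ * c * n * n ^ Fintype.card W := by gcongr
      _ = μ * (c / n) * n ^ Fintype.card W * n ^ 2 := by field_simp
  refine hfar N ?_
  have hbudget : c * n = c / n * n ^ 2 := by field_simp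
  rw [hbudget]
  refine (isGreatest_removalDelta H γ (c / n)).1.2.canMakeFree (hfew.trans_le ?_) (hdeg N)
  gcongr
  exact hlin _ ⟨by positivity, (div_lt_one hn).2 hcn⟩

end Transfer

section ClusteredTuran

/-- The complete `(p + 1)`-partite graph with parts `Fin N × Q`, whose part `0` is further divided
into the clusters `{i} × Q`, each of which is made complete. -/
def clusteredTuran (p N : ℕ) (Q : Type*) : SimpleGraph (Fin (p + 1) × Fin N × Q) where
  Adj x y := x.1 ≠ y.1 ∨ (x.1 = 0 ∧ x.2.1 = y.2.1 ∧ x ≠ y)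
  symm := ⟨by
    rintro x y (h | ⟨h0, hcluster, hne⟩)
    · exact Or.inl h.symm
    · by_cases h : x.1 = y.1
      · exact Or.inr ⟨h ▸ h0, hcluster.symm, hne.symm⟩
      · exact Or.inl (Ne.symm h)⟩
  loopless := ⟨by simp⟩

variable {p N s : ℕ} {Q : Type*}

open Classical in
theorem le_degree_clusteredTuran [Fintype Q] (x : Fin (p + 1) × Fin N × Q) :
    p * (N * Fintype.card Q) ≤ (clusteredTuran p N Q).degree x := by
  calc p * (N * Fintype.card Q) = #({x.1}ᶜ ×ˢ (univ : Finset (Fin N × Q))) := by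
        simp [card_compl]
    _ ≤ #((clusteredTuran p N Q).neighborFinset x) := card_le_card fun y hy =>
        (mem_neighborFinset _ _ _).2 (Or.inl (by simpa [eq_comm] using hy))
    _ = _ := card_neighborFinset_eq_degree _ _

theorem exists_cluster_forall_edge_ne {E : Finset (Sym2 (Fin (p + 1) × Fin N × Q))}
    (hE : #E < N) : ∃ i : Fin N, ∀ z ∈ E, ∃ x ∈ z, x.2.1 ≠ i := by
  classical
  obtain ⟨i, -, hi⟩ := exists_mem_notMem_of_card_lt_card
    (s := E.image fun z => z.out.1.2.1) (t := univ)
    (by simpa using card_image_le.trans_lt hE)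
  exact ⟨i, fun z hz => ⟨z.out.1, z.out_fst_mem, fun h => hi (mem_image.2 ⟨z, hz, h⟩)⟩⟩

theorem isContained_clusteredTuran_deleteEdges
    {E : Set (Sym2 (Fin (p + 1) × Fin N × Bool × Fin s))} {i : Fin N}
    (hi : ∀ z ∈ E, ∃ x ∈ z, x.2.1 ≠ i) :
    completeEquipartiteGraph (p + 2) s ⊑ (clusteredTuran p N (Bool × Fin s)).deleteEdges E := by
  -- The truncated `a - 1` places the classes `0` and `1` both in part `0`.
  let f (a : Fin (p + 2) × Fin s) : Fin (p + 1) × Fin N × Bool × Fin s :=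
    (⟨a.1 - 1, by omega⟩, i, decide (a.1 = 0), a.2)
  have hf : Function.Injective f := by
    rintro ⟨a, j⟩ ⟨b, j'⟩ h
    simp only [f, Prod.mk.injEq, true_and, decide_eq_decide, Fin.ext_iff,
      Fin.val_zero] at h ⊢
    omega
  refine ⟨⟨⟨f, fun {a b} hab => (deleteEdges_adj).2 ⟨?_, fun hmem => ?_⟩⟩, hf⟩⟩
  · have hab' : a.1 ≠ b.1 := hab
    by_cases hpart : (f a).1 = (f b).1
    · refine Or.inr ⟨?_, rfl, hf.ne fun h => hab' (congrArg Prod.fst h)⟩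
      simp only [f, ne_eq, Fin.ext_iff, Fin.val_zero] at hpart hab' ⊢
      omega
    · exact Or.inl hpart
  · obtain ⟨x, hx, hne⟩ := hi _ hmem
    rcases Sym2.mem_iff.1 hx with rfl | rfl <;> exact hne rfl

theorem not_canMakeFree_clusteredTuran {m : ℝ} (hm : m < N) :
    ¬ CanMakeFree (completeEquipartiteGraph (p + 2) s) (clusteredTuran p N (Bool × Fin s)) m := by
  rintro ⟨E, -, hE, hfree⟩
  obtain ⟨i, hi⟩ := exists_cluster_forall_edge_ne (E := E) (by exact_mod_cast hE.trans_lt hm)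
  exact hfree (isContained_clusteredTuran_deleteEdges hi)

theorem exists_classes_map_cluster_eq (hs : 0 < s)
    {y : Fin (p + 2) × Fin s → Fin (p + 1) × Fin N × Q}
    (hy : completeEquipartiteGraph (p + 2) s ≤ (clusteredTuran p N Q).comap y) :
    ∃ a b, a ≠ b ∧ ∀ j j',
      ((y (a, j)).1, (y (a, j)).2.1) = ((y (b, j')).1, (y (b, j')).2.1) := by
  -- The representative of a class lies in part `0` only if the whole class does.
  have hrep (a : Fin (p + 2)) : ∃ j, (y (a, j)).1 = 0 → ∀ j', (y (a, j')).1 = 0 := by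
    by_cases h : ∀ j', (y (a, j')).1 = 0
    · exact ⟨⟨0, hs⟩, fun _ => h⟩
    · obtain ⟨j, hj⟩ := not_forall.1 h
      exact ⟨j, fun h0 => absurd h0 hj⟩
  choose rep hrep using hrep
  obtain ⟨a, b, hab, hpart⟩ := Fintype.exists_ne_map_eq_of_card_lt
    (fun a => (y (a, rep a)).1) (by simp)
  have hadj (j j' : Fin s) : (clusteredTuran p N Q).Adj (y (a, j)) (y (b, j')) :=
    hy (show (completeEquipartiteGraph (p + 2) s).Adj (a, j) (b, j') from hab)
  have ha0 : (y (a, rep a)).1 = 0 := ((hadj _ _).resolve_left (not_not.2 hpart)).1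
  have ha := hrep a ha0
  have hb := hrep b (hpart.symm.trans ha0)
  refine ⟨a, b, hab, fun j j' => ?_⟩
  have hj : (y (a, j)).1 = (y (b, j')).1 := (ha j).trans (hb j').symm
  exact Prod.ext hj ((hadj j j').resolve_left (not_not.2 hj)).2.1

theorem labelledCopyCount_clusteredTuran_mul_le [Fintype Q] (hs : 2 ≤ s) :
    (clusteredTuran p N Q).labelledCopyCount (completeEquipartiteGraph (p + 2) s) *
        Fintype.card (Fin (p + 1) × Fin N × Q) ^ 2 ≤
      (p + 2) ^ 2 * (Fintype.card Q ^ 2 * Fintype.card (Fin (p + 1) × Fin N × Q) ^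
        Fintype.card (Fin (p + 2) × Fin s)) := by
  classical
  let cluster (x : Fin (p + 1) × Fin N × Q) := (x.1, x.2.1)
  have hcluster (k) : #{x | cluster x = k} ≤ Fintype.card Q := by
    refine card_le_card_of_injOn (t := univ) (fun x => x.2.2) (by simp) fun x hx x' hx' h => ?_
    have hxx' : cluster x = cluster x' := (mem_filter.1 hx).2.trans (mem_filter.1 hx').2.symm
    obtain ⟨hpart, hindex⟩ := Prod.ext_iff.1 hxx'
    exact Prod.ext hpart (Prod.ext hindex h)
  rw [labelledCopyCount_eq_card_filter]
  refine (Nat.mul_le_mul_right _ (card_le_card fun y hy => ?_)).trans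
    (card_exists_classes_fiber_eq_mul_le hs cluster hcluster)
  simp only [mem_filter, mem_univ, true_and] at hy ⊢
  exact exists_classes_map_cluster_eq (by omega) hy.2

end ClusteredTuran

section Threshold

variable {r s : ℕ} {γ : ℝ}

theorem hasLinearRemoval_completeEquipartiteGraph (hγ : ∀ i < r, i * (1 - γ) < 1) :
    HasLinearRemoval (completeEquipartiteGraph r s) γ := by
  have hpos : ∀ i < r, 0 < 1 - i * (1 - γ) := fun i hi => sub_pos.2 (hγ i hi)
  refine hasLinearRemoval_of_le_homDensity (α := (∏ i ∈ range r, (1 - i * (1 - γ))) ^ s ^ r)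
    (pow_pos (prod_pos fun i hi => hpos i (mem_range.1 hi)) _) fun n _ G hdeg => ?_
  classical
  have hclique := prod_range_le_homDensity_top (γ := γ) (G := G) (fun v => by
    rw [Fintype.card_fin]
    exact hdeg.trans (Nat.cast_le.2 (by convert G.minDegree_le_degree v))) r
    fun i hi => (hpos i hi).le
  calc _ ≤ homDensity (⊤ : SimpleGraph (Fin r)) G ^ s ^ r :=
        pow_le_pow_left₀ (prod_nonneg fun i hi => (hpos i (mem_range.1 hi)).le) hclique _
    _ ≤ homDensity (completeEquipartiteGraph r s) G := pow_homDensity_le_homDensity_blowUp s ⊤ G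

theorem not_hasLinearRemoval_completeEquipartiteGraph {p : ℕ} (hs : 2 ≤ s)
    (hγ : γ ≤ p / (p + 1)) : ¬ HasLinearRemoval (completeEquipartiteGraph (p + 2) s) γ := by
  classical
  let K : ℝ := (p + 1) * (2 * s)
  have : (0 : ℝ) < s := by exact_mod_cast (by omega : 0 < s)
  have hK : 0 < K := by positivity
  have hcard (N : ℕ) : (Fintype.card (Fin (p + 1) × Fin (N + 1) × Bool × Fin s) : ℝ) =
      K * (N + 1) := by
    simp [K]
    ring
  refine not_hasLinearRemoval_of_tendsto_card (c := 1 / (2 * K))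
    (C := (p + 2) ^ 2 * Fintype.card (Bool × Fin s) ^ 2)
    (G := fun N => clusteredTuran p (N + 1) (Bool × Fin s)) ?_ (fun N => ?_) (fun N => ?_)
    (by positivity) fun N => ?_
  · refine Filter.tendsto_atTop_mono (fun N => ?_) Filter.tendsto_id
    have : Nonempty (Fin s) := ⟨⟨0, by omega⟩⟩
    calc N ≤ Fintype.card (Fin (N + 1)) := by simp
      _ ≤ _ := Fintype.card_le_of_surjective (fun x => x.2.1) fun i => by
        simp
  · have : Nonempty (Fin (p + 1) × Fin (N + 1) × Bool × Fin s) :=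
      ⟨0, 0, true, ⟨0, by omega⟩⟩
    calc γ * _ ≤ p / (p + 1) * (K * (N + 1)) := by
          rw [hcard]
          gcongr
      _ = (p * ((N + 1) * Fintype.card (Bool × Fin s)) : ℕ) := by
          simp [K]
          field_simp
      _ ≤ _ := Nat.cast_le.2 (le_minDegree_of_forall_le_degree _ _ fun x => by
          convert le_degree_clusteredTuran x)
  · rw [mul_assoc]
    exact_mod_cast labelledCopyCount_clusteredTuran_mul_le hs
  · refine not_canMakeFree_clusteredTuran ?_
    have hbudget : 1 / (2 * K) * (K * (N + 1)) = ((N : ℝ) + 1) / 2 := by field_simp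
    rw [hcard, hbudget]
    push_cast
    linarith

theorem hasLinearRemoval_completeEquipartiteGraph_iff (hr : 2 ≤ r) (hs : 2 ≤ s) (hγ : γ ≤ 1) :
    HasLinearRemoval (completeEquipartiteGraph r s) γ ↔ ((r : ℝ) - 2) / (r - 1) < γ := by
  obtain ⟨p, rfl⟩ := Nat.exists_eq_add_of_le' hr
  have hp : (0 : ℝ) < p + 1 := by positivity
  have hthreshold : (((p + 2 : ℕ) : ℝ) - 2) / ((p + 2 : ℕ) - 1) = p / (p + 1) := by
    push_cast
    ring_nf
  rw [hthreshold]
  refine ⟨fun h => ?_, fun h => hasLinearRemoval_completeEquipartiteGraph fun i hi => ?_⟩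
  · by_contra hle
    exact not_hasLinearRemoval_completeEquipartiteGraph hs (not_lt.1 hle) h
  · have hi' : (i : ℝ) ≤ p + 1 := by exact_mod_cast Nat.lt_succ_iff.1 hi
    rw [div_lt_iff₀ hp] at h
    nlinarith

end Threshold

end MinDegreeRemoval

open MinDegreeRemoval in
theorem proposition4p2_general (r s : ℕ) (hr : 2 ≤ r) (hs : 2 ≤ s) :
    linearRemovalThreshold (SimpleGraph.completeEquipartiteGraph r s) =
      ((r : ℝ) - 2) / ((r : ℝ) - 1) := by
  have hr' : (2 : ℝ) ≤ r := by exact_mod_cast hr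
  have hthreshold₀ : 0 ≤ ((r : ℝ) - 2) / (r - 1) := div_nonneg (by linarith) (by linarith)
  have hthreshold₁ : ((r : ℝ) - 2) / (r - 1) < 1 := (div_lt_one (by linarith)).2 (by linarith)
  have hset : {γ : ℝ | γ ∈ Set.Icc (0 : ℝ) 1 ∧
      HasLinearRemoval (SimpleGraph.completeEquipartiteGraph r s) γ} =
      Set.Ioc (((r : ℝ) - 2) / (r - 1)) 1 := by
    ext γ
    refine ⟨fun ⟨hγ, h⟩ => ?_, fun hγ => ?_⟩
    · exact ⟨(hasLinearRemoval_completeEquipartiteGraph_iff hr hs hγ.2).1 h, hγ.2⟩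
    · exact ⟨⟨hthreshold₀.trans hγ.1.le, hγ.2⟩,
        (hasLinearRemoval_completeEquipartiteGraph_iff hr hs hγ.2).2 hγ.1⟩
  calc _ = sInf (Set.Ioc (((r : ℝ) - 2) / (r - 1)) 1) := congrArg sInf hset
    _ = _ := csInf_Ioc hthreshold₁

theorem proposition4p2 (r s : ℕ) (hr : 3 ≤ r) (hs : 2 ≤ s) :
    MinDegreeRemoval.linearRemovalThreshold (SimpleGraph.completeEquipartiteGraph r s) =
      ((r : ℝ) - 2) / ((r : ℝ) - 1) :=
  proposition4p2_general r s (by omega) hs
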